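/- **Theorem 2.** Let $U\subseteq\mathbb R^2$ be open, let $A_0,A_1,A_2,B_0,\dots,B_4$ be real functions of $(x,y)\in U$ with $A_0,A_1,A_2$ smooth, and consider the third-order ODE $$y'''+(A_2y'^2-A_1y'+A_0)\,y''+B_4y'^4-B_3y'^3+B_2y'^2-B_1y'+B_0=0.\qquad(*)$$ Put $c=A_2/3$, $g=A_1/2$, $h=A_0$. Suppose that on $U$ $$B_4=\tfrac13A_{2,y},\qquad B_3=\tfrac12A_{1,y}-\tfrac13A_{2,x},\qquad B_2=A_{0,y}-\tfrac12A_{1,x},$$ and that there is a smooth function $d$ on $U$ with $$d_x=-B_0,\qquad d_y=B_1+A_{0,x}$$ (these determine $d$ up to an additive constant on each component of $U$) such that $c,d,g,h$ satisfy the Lie criteria on $U$ in one of the following two forms. (i) In terms of the four coefficients: $$3(ch)_x+3dc_y+6cd_y-2gg_x-gh_y-3c_{xx}-2g_{xy}-h_{yy}=0,$$ $$3(dg)_y+3cd_x+6dc_x-2hh_y-hg_x-3d_{yy}-2h_{xy}-g_{xx}=0.$$ (ii) In terms of the coefficients of a geodesic system: there are smooth functions $a,b,e,f$ on $U$ with $h=a-2e$,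 $g=f-2b$, $$3b_x+2g_x+h_y+3be-3cd=0,\qquad b_y-c_x+b^2+bg+ch+ce=0,$$ $$d_y-e_x-bd-dg-e^2-eh=0,\qquad 3e_y+2h_y+g_x+3be-3cd=0,$$ and the Christoffel symbols $\Gamma^1_{11}=-a$, $\Gamma^1_{12}=-b$, $\Gamma^1_{22}=-c$, $\Gamma^2_{11}=-d$, $\Gamma^2_{12}=-e$, $\Gamma^2_{22}=-f$ are consistent with a metric, i.e. there are smooth $p=g_{11}$, $q=g_{12}=g_{21}$, $r=g_{22}$ on $U$ with $pr-q^2\neq0$ and $$p_x=-2(ap+dq),\quad q_x=-bp-(a+e)q-dr,\quad r_x=-2(bq+er),$$ $$p_y=-2(bp+eq),\quad q_y=-cp-(b+f)q-er,\quad r_y=-2(cq+fr).$$ Then $(*)$ is linearizable, in the following sense: $(*)$ is the total derivative with respect to $x$ of a second-order ODE $y''+G(x,y,y')=0$, with $G$ smooth for $(x,y)\in U$, $y'\in\mathbb R$, that is linearizable by point transformations; that is, every point of $U$ has an open neighbourhood $V\subseteq U$ with a point transformation $u=\varphi(x,y)$, $v=\psi(x,y)$ (smooth, injective, with non-vanishing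 Jacobian determinant on $V$) that carries the second-order ODE to $d^2v/du^2=0$: a $C^2$ function $y$ on an open interval with graph in $V$ solves $y''+G(x,y,y')=0$ if and only if the image of its graph lies on a straight line $\alpha u+\beta v=\gamma$, $(\alpha,\beta)\ne(0,0)$. -/

import Mathlib

open Set
open scoped ContDiff

noncomputable section

/-- The partial derivative with respect to `x` of a function of `(x, y)`. -/
def partialX (f : ℝ × ℝ → ℝ) (z : ℝ × ℝ) : ℝ := fderiv ℝ f z (1, 0)

/-- The partial derivative with respect to `y` of a function of `(x, y)`. -/
def partialY (f : ℝ × ℝ → ℝ) (z : ℝ × ℝ) : ℝ := fderiv ℝ f z (0, 1)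

/-- `y` is a twice continuously differentiable function on the open interval `I` whose graph
lies in `V`. -/
structure IsCurveIn (V : Set (ℝ × ℝ)) (I : Set ℝ) (y : ℝ → ℝ) : Prop where
  isOpen : IsOpen I
  ordConnected : I.OrdConnected
  contDiffOn : ContDiffOn ℝ 2 y I
  graph_mem : ∀ t ∈ I, (t, y t) ∈ V

/-- `y` solves the second-order equation `y'' + G(x, y, y') = 0` on `I`. -/
def SolvesSecondOrder (G : ℝ × ℝ × ℝ → ℝ) (I : Set ℝ) (y : ℝ → ℝ) : Prop :=
  ∀ t ∈ I, deriv (deriv y) t + G (t, y t, deriv y t) = 0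

/-- A point transformation `u = φ(x, y)`, `v = ψ(x, y)` on `V`: a smooth injective map with
nowhere vanishing Jacobian determinant. -/
structure IsPointTransformation (V : Set (ℝ × ℝ)) (φ ψ : ℝ × ℝ → ℝ) : Prop where
  smooth_fst : ContDiffOn ℝ ∞ φ V
  smooth_snd : ContDiffOn ℝ ∞ ψ V
  injOn : InjOn (fun z => (φ z, ψ z)) V
  jacobian_ne_zero : ∀ z ∈ V, partialX φ z * partialY ψ z - partialY φ z * partialX ψ z ≠ 0

/-- The equation `y'' + G(x, y, y') = 0` over `U` is linearizable by point transformations: near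
every point of `U` some point transformation carries it to `d²v/du² = 0`, that is, the graphs
of its solutions are exactly the curves mapped into straight lines `α u + β v = γ`. -/
def PointLinearizable (U : Set (ℝ × ℝ)) (G : ℝ × ℝ × ℝ → ℝ) : Prop :=
  ∀ z ∈ U, ∃ V : Set (ℝ × ℝ), IsOpen V ∧ z ∈ V ∧ V ⊆ U ∧
    ∃ φ ψ : ℝ × ℝ → ℝ, IsPointTransformation V φ ψ ∧
      ∀ (I : Set ℝ) (y : ℝ → ℝ), IsCurveIn V I y →
        (SolvesSecondOrder G I y ↔
          ∃ α β γ : ℝ, (α, β) ≠ (0, 0) ∧ ∀ t ∈ I, α * φ (t, y t) + β * ψ (t, y t) = γ)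

/-- The third-order equation `y''' + F(x, y, y', y'') = 0` over `U` is the total derivative with
respect to `x` of the second-order equation `y'' + G(x, y, y') = 0`. Here `p` and `q` stand for
`y'` and `y''`, and the derivative of `G` in the direction `(1, p, q)` is
`G_x + p G_y + q G_p`. -/
def IsTotalDerivativeOf (U : Set (ℝ × ℝ)) (F : ℝ × ℝ × ℝ × ℝ → ℝ) (G : ℝ × ℝ × ℝ → ℝ) : Prop :=
  ∀ x y p q : ℝ, (x, y) ∈ U → F (x, y, p, q) = fderiv ℝ G (x, y, p) (1, p, q)

/-- The third-order equation `y''' + F(x, y, y', y'') = 0` over `U` is linearizable (in the sense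
of differentiated point-linearizable equations): it is the total derivative of a smooth
second-order equation that is linearizable by point transformations. -/
def LinearizableThirdOrder (U : Set (ℝ × ℝ)) (F : ℝ × ℝ × ℝ × ℝ → ℝ) : Prop :=
  ∃ G : ℝ × ℝ × ℝ → ℝ, ContDiffOn ℝ ∞ G {w | (w.1, w.2.1) ∈ U} ∧
    IsTotalDerivativeOf U F G ∧ PointLinearizable U G

/-- The equation
`y''' + (A₂ y'² - A₁ y' + A₀) y'' + B₄ y'⁴ - B₃ y'³ + B₂ y'² - B₁ y' + B₀ = 0`, written as
`y''' + F(x, y, y', y'') = 0`. -/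
def thirdOrderTerms (A₀ A₁ A₂ B₀ B₁ B₂ B₃ B₄ : ℝ × ℝ → ℝ) : ℝ × ℝ × ℝ × ℝ → ℝ :=
  fun (x, y, p, q) =>
    (A₂ (x, y) * p ^ 2 - A₁ (x, y) * p + A₀ (x, y)) * q
      + B₄ (x, y) * p ^ 4 - B₃ (x, y) * p ^ 3 + B₂ (x, y) * p ^ 2 - B₁ (x, y) * p + B₀ (x, y)

/-- The Lie criteria for `y'' + c y'³ - g y'² + h y' - d = 0` in terms of the four coefficients
alone. -/
structure LieCriteria (U : Set (ℝ × ℝ)) (c d g h : ℝ × ℝ → ℝ) : Prop where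
  first : ∀ z ∈ U,
    3 * partialX (fun w => c w * h w) z + 3 * d z * partialY c z + 6 * c z * partialY d z
      - 2 * g z * partialX g z - g z * partialY h z
      - 3 * partialX (partialX c) z - 2 * partialY (partialX g) z - partialY (partialY h) z = 0
  second : ∀ z ∈ U,
    3 * partialY (fun w => d w * g w) z + 3 * c z * partialX d z + 6 * d z * partialX c z
      - 2 * h z * partialY h z - h z * partialX g z
      - 3 * partialY (partialY d) z - 2 * partialY (partialX h) z - partialX (partialX g) z = 0

/-- The Lie criteria for `y'' + c y'³ - g y'² + h y' - d = 0` in terms of the coefficients of a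
system of geodesic equations
`x'' = a x'² + 2 b x' y' + c y'²`, `y'' = d x'² + 2 e x' y' + f y'²`
that projects to it, i.e. with `h = a - 2 e` and `g = f - 2 b`. -/
structure LieCriteriaAux (U : Set (ℝ × ℝ)) (c d g h a b e f : ℝ × ℝ → ℝ) : Prop where
  smooth_a : ContDiffOn ℝ ∞ a U
  smooth_b : ContDiffOn ℝ ∞ b U
  smooth_e : ContDiffOn ℝ ∞ e U
  smooth_f : ContDiffOn ℝ ∞ f U
  h_eq : ∀ z ∈ U, h z = a z - 2 * e z
  g_eq : ∀ z ∈ U, g z = f z - 2 * b z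
  first : ∀ z ∈ U, 3 * partialX b z + 2 * partialX g z + partialY h z
    + 3 * b z * e z - 3 * c z * d z = 0
  second : ∀ z ∈ U, partialY b z - partialX c z + b z ^ 2 + b z * g z + c z * h z
    + c z * e z = 0
  third : ∀ z ∈ U, partialY d z - partialX e z - b z * d z - d z * g z - e z ^ 2
    - e z * h z = 0
  fourth : ∀ z ∈ U, 3 * partialY e z + 2 * partialY h z + partialX g z
    + 3 * b z * e z - 3 * c z * d z = 0

/-- The Christoffel symbols
`Γ¹₁₁ = -a, Γ¹₁₂ = -b, Γ¹₂₂ = -c, Γ²₁₁ = -d, Γ²₁₂ = -e, Γ²₂₂ = -f`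
are consistent with the non-degenerate metric `g₁₁ = p, g₁₂ = g₂₁ = q, g₂₂ = r`. -/
structure MetricConsistent (U : Set (ℝ × ℝ)) (a b c d e f p q r : ℝ × ℝ → ℝ) : Prop where
  smooth_p : ContDiffOn ℝ ∞ p U
  smooth_q : ContDiffOn ℝ ∞ q U
  smooth_r : ContDiffOn ℝ ∞ r U
  nondegenerate : ∀ z ∈ U, p z * r z - q z ^ 2 ≠ 0
  p_x : ∀ z ∈ U, partialX p z = -2 * (a z * p z + d z * q z)
  q_x : ∀ z ∈ U, partialX q z = -(b z * p z) - (a z + e z) * q z - d z * r z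
  r_x : ∀ z ∈ U, partialX r z = -2 * (b z * q z + e z * r z)
  p_y : ∀ z ∈ U, partialY p z = -2 * (b z * p z + e z * q z)
  q_y : ∀ z ∈ U, partialY q z = -(c z * p z) - (b z + f z) * q z - e z * r z
  r_y : ∀ z ∈ U, partialY r z = -2 * (c z * q z + f z * r z)

end

/-! ### Frobenius theorem for linear total differential equations `dW = A W` -/

section Frobenius

set_option maxSynthPendingDepth 3

open Metric Filter Topology

variable {F E : Type*} [NormedAddCommGroup F] [NormedSpace ℝ F]
  [NormedAddCommGroup E] [NormedSpace ℝ E]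

/-! Take G = c y'³ - g y'² + h y' - d. Comparing coefficients in its total derivative gives exactly
the relations imposed on the Bᵢ and on d, so the content is the linearizability of y'' + G = 0.

This equation describes the unparametrized geodesics of any connection with h = a - 2e and g = f -
2b. If s has zero covariant Hessian, its total derivative w = s_x + y' s_y along a graph satisfies
w' = -(a + 2by' + cy'²) w + (y'' + G) s_y. Hence two such functions with independent differentials
straighten the solutions (`solvesSecondOrder_iff_image_in_line`).

To treat both forms of the Lie criteria at once, the Hessian system is allowed potentials P, Q, R.
Form (ii) says that the system with zero potentials is integrable. Form (i) says the same of the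
trace-free connection with suitable potentials. In either case Frobenius gives a three-dimensional
local solution space. Quotients t/s, r/s of solutions have zero Hessian for a projectively
equivalent connection, which has the same G (`IsHessianSolution.div`), and they are the coordinates
sought (`IsFlatHessianSystem.pointLinearizable`). -/

theorem norm_taylor_one_le_of_lipschitz_deriv {f : F → E} {f' : F → F →L[ℝ] E} {s : Set F}
    (hs : Convex ℝ s) {M : ℝ} (hM : 0 ≤ M) (hf : ∀ z ∈ s, HasFDerivAt f (f' z) z)
    (hL : ∀ z ∈ s, ∀ w ∈ s, ‖f' z - f' w‖ ≤ M * ‖z - w‖) {p q : F} (hp : p ∈ s) (hq : q ∈ s) :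
    ‖f q - f p - f' p (q - p)‖ ≤ M * ‖q - p‖ ^ 2 := by
  have hsub : segment ℝ p q ⊆ s := hs.segment_subset hp hq
  have := Convex.norm_image_sub_le_of_norm_hasFDerivWithin_le' (f := f) (f' := f')
    (φ := f' p) (C := M * ‖q - p‖) (s := segment ℝ p q)
    (fun x hx => (hf x (hsub hx)).hasFDerivWithinAt)
    (fun x hx => (hL x (hsub hx) p hp).trans
      (mul_le_mul_of_nonneg_left (norm_sub_le_of_mem_segment hx) hM))
    (convex_segment p q) (left_mem_segment ℝ p q) (right_mem_segment ℝ p q)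
  calc _ ≤ _ := this
    _ = _ := by ring

/-- Linear ordinary differential equations with small coefficients are solvable on `[0, 1]`. -/
theorem exists_solution_linear_ode [CompleteSpace E] {B : ℝ → E →L[ℝ] E}
    (hB : ContinuousOn B (Icc 0 1)) (hB' : ∀ t ∈ Icc (0 : ℝ) 1, ‖B t‖ ≤ 1 / 2) (w₀ : E) :
    ∃ u : ℝ → E, u 0 = w₀ ∧
      ∀ t ∈ Icc (0 : ℝ) 1, HasDerivWithinAt u (B t (u t)) (Icc 0 1) t := by
  -- The ball of radius `‖w₀‖` about `w₀` lies in `‖x‖ ≤ 2‖w₀‖`, so the bound `1 / 2` keeps the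
  -- speed at most `‖w₀‖`. Unit time cannot leave this ball, and the solution covers all of `[0,
  -- 1]`.
  have hP : IsPicardLindelof (fun t x => B t x) (tmin := 0) (tmax := 1)
      ⟨0, by simp⟩ w₀ ‖w₀‖₊ 0 ‖w₀‖₊ 1 := by
    refine ⟨fun t ht => ?_, fun x _ => hB.clm_apply continuousOn_const, fun t ht x hx => ?_, ?_⟩
    · refine ((B t).lipschitz.weaken ?_).lipschitzOnWith
      exact_mod_cast (hB' t ht).trans (by norm_num)
    · have hx' : ‖x‖ ≤ 2 * ‖w₀‖ := by
        have h1 : ‖x - w₀‖ ≤ ‖w₀‖ := by simpa [dist_eq_norm] using hx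
        have h2 := norm_le_norm_add_norm_sub' x w₀
        linarith
      calc ‖B t x‖ ≤ ‖B t‖ * ‖x‖ := (B t).le_opNorm x
        _ ≤ 1 / 2 * (2 * ‖w₀‖) := by gcongr; exact hB' t ht
        _ = _ := by simp
    · simp
  exact hP.exists_eq_forall_mem_Icc_hasDerivWithinAt₀

theorem norm_le_gronwallBound_of_hasDerivWithinAt_Icc {f f' : ℝ → E} {δ K ε : ℝ}
    (hf : ∀ t ∈ Icc (0 : ℝ) 1, HasDerivWithinAt f (f' t) (Icc 0 1) t)
    (h0 : ‖f 0‖ ≤ δ) (hb : ∀ t ∈ Icc (0 : ℝ) 1, ‖f' t‖ ≤ K * ‖f t‖ + ε) :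
    ∀ t ∈ Icc (0 : ℝ) 1, ‖f t‖ ≤ gronwallBound δ K ε t := by
  intro t ht
  have := norm_le_gronwallBound_of_norm_deriv_right_le (f := f) (f' := f') (a := 0) (b := 1)
    (fun t ht => (hf t ht).continuousWithinAt)
    (fun t ht => (hf t (Ico_subset_Icc_self ht)).mono_of_mem_nhdsWithin
      (mem_of_superset (Icc_mem_nhdsGE ht.2) (Icc_subset_Icc_left ht.1))) h0
    (fun t ht => hb t (Ico_subset_Icc_self ht)) t ht
  simpa using this

/-- **Frobenius theorem** for the linear total differential equation `dW = A W`, with quantitative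
hypotheses on a ball: the solution is found by integrating along the radii. -/
theorem exists_parallel_of_flat_ball [CompleteSpace E] {A : F → F →L[ℝ] E →L[ℝ] E}
    {A' : F → F →L[ℝ] F →L[ℝ] E →L[ℝ] E} {z₀ : F} {r M : ℝ} (hr : 0 < r) (hM : 0 ≤ M)
    (hMr : M * r ≤ 1 / 2)
    (hA : ∀ z ∈ ball z₀ r, HasFDerivAt A (A' z) z)
    (hbound : ∀ z ∈ ball z₀ r, ‖A z‖ ≤ M)
    (hbound' : ∀ z ∈ ball z₀ r, ‖A' z‖ ≤ M)
    (hL' : ∀ z ∈ ball z₀ r, ∀ w ∈ ball z₀ r, ‖A' z - A' w‖ ≤ M * ‖z - w‖)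
    (hflat : ∀ z ∈ ball z₀ r, ∀ (u v : F) (w : E),
      A' z u v w + A z v (A z u w) = A' z v u w + A z u (A z v w)) (w₀ : E) :
    ∃ W : F → E, W z₀ = w₀ ∧ ∀ z ∈ ball z₀ r, HasFDerivAt W ((A z).flip (W z)) z := by
  have hconv : Convex ℝ (ball z₀ r) := convex_ball z₀ r
  have hL : ∀ z ∈ ball z₀ r, ∀ w ∈ ball z₀ r, ‖A z - A w‖ ≤ M * ‖z - w‖ := fun z hz w hw =>
    Convex.norm_image_sub_le_of_norm_hasFDerivWithin_le
      (fun x hx => (hA x hx).hasFDerivWithinAt) hbound' hconv hw hz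
  have hmem : ∀ v : F, ‖v‖ < r → ∀ t ∈ Icc (0 : ℝ) 1, z₀ + t • v ∈ ball z₀ r := by
    intro v hv t ht
    rw [mem_ball_iff_norm, add_sub_cancel_left, norm_smul, Real.norm_of_nonneg ht.1]
    exact (mul_le_of_le_one_left (norm_nonneg v) ht.2).trans_lt hv
  have hline : ∀ v : F, ‖v‖ < r → ∀ t ∈ Icc (0 : ℝ) 1,
      HasDerivAt (fun t : ℝ => A (z₀ + t • v)) (A' (z₀ + t • v) v) t := by
    intro v hv t ht
    have h1 : HasDerivAt (fun t : ℝ => z₀ + t • v) v t := by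
      simpa using ((hasDerivAt_id t).smul_const v).const_add z₀
    exact (hA _ (hmem v hv t ht)).comp_hasDerivAt t h1
  have hBnorm : ∀ v : F, ‖v‖ < r → ∀ t ∈ Icc (0 : ℝ) 1, ‖A (z₀ + t • v) v‖ ≤ 1 / 2 := by
    intro v hv t ht
    calc _ ≤ ‖A (z₀ + t • v)‖ * ‖v‖ := ContinuousLinearMap.le_opNorm _ _
      _ ≤ M * r := by gcongr; exact hbound _ (hmem v hv t ht)
      _ ≤ 1 / 2 := hMr
  have hex : ∀ v : F, ‖v‖ < r → ∃ u : ℝ → E, u 0 = w₀ ∧ ∀ t ∈ Icc (0 : ℝ) 1,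
      HasDerivWithinAt u (A (z₀ + t • v) v (u t)) (Icc 0 1) t := by
    intro v hv
    refine exists_solution_linear_ode (fun t ht => ?_) (hBnorm v hv) w₀
    exact ((hline v hv t ht).continuousAt.clm_apply continuousAt_const).continuousWithinAt
  -- `u v` is the solution along the ray with velocity `v`; the candidate is `W (z₀ + v) = u v 1`.
  choose! u hu0 hu using hex
  have hubound : ∀ v : F, ‖v‖ < r → ∀ t ∈ Icc (0 : ℝ) 1, ‖u v t‖ ≤ ‖w₀‖ * Real.exp 1 := by
    intro v hv t ht
    have h1 := norm_le_gronwallBound_of_hasDerivWithinAt_Icc (hu v hv)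
      (congrArg norm (hu0 v hv)).le
      (K := 1) (ε := 0) (fun t ht => by
        have := (A (z₀ + t • v) v).le_opNorm (u v t)
        have h2 := hBnorm v hv t ht
        have h3 := mul_le_mul_of_nonneg_right h2 (norm_nonneg (u v t))
        nlinarith [norm_nonneg (u v t)]) t ht
    rw [gronwallBound_ε0, one_mul] at h1
    refine h1.trans ?_
    gcongr
    exact ht.2
  refine ⟨fun z => u (z - z₀) 1, ?_, fun z hz => ?_⟩
  · have h := norm_le_gronwallBound_of_hasDerivWithinAt_Icc
      (f := fun t => u 0 t - w₀) (δ := 0) (K := 0) (ε := 0)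
      (fun t ht => (hu 0 (by simpa using hr) t ht).sub_const w₀)
      (by simp [hu0 0 (by simpa using hr)]) (by simp) 1 (by simp)
    simpa [gronwallBound_ε0_δ0, sub_eq_zero] using h
  obtain ⟨v, rfl⟩ : ∃ v, z = z₀ + v := ⟨z - z₀, by simp⟩
  have hv : ‖v‖ < r := by simpa [mem_ball_iff_norm] using hz
  set C := ‖w₀‖ * Real.exp 1 with hC
  have hC0 : 0 ≤ C := by positivity
  -- `N` collects the quadratic remainders `e2`, `e3` and `e6` below.
  set N := (M * r + M) * C + (M * r + M) * M * C with hN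
  have hN0 : 0 ≤ N := by positivity
  -- The variation of `u v` in direction `k` should be `t • A k (u v t)`. The error vanishes at `t =
  -- 0` and solves a linear equation with source of order `‖k‖²`, so Grönwall bounds it.
  have key : ∀ k : F, ‖v + k‖ < r →
      ‖u (v + k) 1 - u v 1 - A (z₀ + v) k (u v 1)‖ ≤ N * ‖k‖ ^ 2 * (Real.exp 1 - 1) := by
    intro k hk
    have h := norm_le_gronwallBound_of_hasDerivWithinAt_Icc
      (f := fun t => u (v + k) t - u v t - t • A (z₀ + t • v) k (u v t))
      (f' := fun t => A (z₀ + t • (v + k)) (v + k) (u (v + k) t) - A (z₀ + t • v) v (u v t)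
        - (t • (A' (z₀ + t • v) v k (u v t) + A (z₀ + t • v) k (A (z₀ + t • v) v (u v t)))
          + (1 : ℝ) • A (z₀ + t • v) k (u v t)))
      (δ := 0) (K := 1) (ε := N * ‖k‖ ^ 2) ?_ ?_ ?_ 1 (by simp)
    · simpa [gronwallBound_of_K_ne_0] using h
    · intro t ht
      refine ((hu _ hk t ht).sub (hu v hv t ht)).sub ?_
      refine (hasDerivWithinAt_id t _).smul ?_
      exact HasDerivWithinAt.clm_apply (((hline v hv t ht).hasDerivWithinAt).clm_apply
        (hasDerivWithinAt_const t _ k) |>.congr_deriv (by simp)) (hu v hv t ht)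
    · simp [hu0 _ hk, hu0 v hv]
    · intro t ht
      have hp := hmem v hv t ht
      have hq := hmem _ hk t ht
      have hut := hubound v hv t ht
      have hBk := hBnorm _ hk t ht
      set p := z₀ + t • v with hpdef
      set q := z₀ + t • (v + k) with hqdef
      have hqp : q - p = t • k := by simp [hpdef, hqdef]
      have hqpn : ‖q - p‖ ≤ ‖k‖ := by
        rw [hqp, norm_smul, Real.norm_of_nonneg ht.1]
        exact mul_le_of_le_one_left (norm_nonneg k) ht.2
      set D := u (v + k) t - u v t - t • A p k (u v t) with hD
      have hsplit : A q (v + k) (u (v + k) t) - A p v (u v t)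
          - (t • (A' p v k (u v t) + A p k (A p v (u v t))) + (1 : ℝ) • A p k (u v t))
          = A q (v + k) D + ((A q - A p - A' p (q - p)) v (u v t) + (A q - A p) k (u v t))
            + t • ((A q - A p) (v + k) (A p k (u v t)) + A p k (A p k (u v t))) := by
        -- Flatness swaps `v` and `k`, which cancels every term linear in `k`.
        rw [hflat p hp v k, hqp, hD]
        simp only [map_sub, map_add, map_smul, sub_apply,
          add_apply, smul_apply, smul_add, smul_sub,
          one_smul]
        abel
      rw [hsplit]
      have e1 : ‖A q (v + k) D‖ ≤ 1 * ‖D‖ := by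
        calc _ ≤ ‖A q (v + k)‖ * ‖D‖ := ContinuousLinearMap.le_opNorm _ _
          _ ≤ 1 * ‖D‖ := by gcongr; linarith
      have hAqp : ‖A q - A p‖ ≤ M * ‖k‖ :=
        (hL q hq p hp).trans (mul_le_mul_of_nonneg_left hqpn hM)
      have e2 : ‖(A q - A p - A' p (q - p)) v (u v t)‖ ≤ M * ‖k‖ ^ 2 * r * C := by
        calc _ ≤ ‖A q - A p - A' p (q - p)‖ * ‖v‖ * ‖u v t‖ :=
              ContinuousLinearMap.le_opNorm₂ _ _ _
          _ ≤ M * ‖q - p‖ ^ 2 * r * C := by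
            gcongr
            exact norm_taylor_one_le_of_lipschitz_deriv hconv hM hA hL' hp hq
          _ ≤ _ := by gcongr
      have e3 : ‖(A q - A p) k (u v t)‖ ≤ M * ‖k‖ * ‖k‖ * C :=
        (ContinuousLinearMap.le_opNorm₂ _ _ _).trans (by gcongr)
      have e0 : ‖A p k (u v t)‖ ≤ M * ‖k‖ * C :=
        (ContinuousLinearMap.le_opNorm₂ _ _ _).trans (by gcongr; exact hbound p hp)
      have e4 : ‖(A q - A p) (v + k) (A p k (u v t))‖ ≤ M * ‖k‖ * r * (M * ‖k‖ * C) :=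
        (ContinuousLinearMap.le_opNorm₂ _ _ _).trans (by gcongr)
      have e5 : ‖A p k (A p k (u v t))‖ ≤ M * ‖k‖ * (M * ‖k‖ * C) :=
        (ContinuousLinearMap.le_opNorm₂ _ _ _).trans (by gcongr; exact hbound p hp)
      have e6 : ‖t • ((A q - A p) (v + k) (A p k (u v t)) + A p k (A p k (u v t)))‖
          ≤ M * ‖k‖ * r * (M * ‖k‖ * C) + M * ‖k‖ * (M * ‖k‖ * C) := by
        rw [norm_smul, Real.norm_of_nonneg ht.1]
        exact (mul_le_of_le_one_left (norm_nonneg _) ht.2).trans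
          ((norm_add_le _ _).trans (add_le_add e4 e5))
      refine (norm_add₃_le).trans
        ((add_le_add (add_le_add e1 ((norm_add_le _ _).trans (add_le_add e2 e3))) e6).trans
        (le_of_eq ?_))
      rw [hN]; ring
  rw [hasFDerivAt_iff_isLittleO_nhds_zero]
  have hev : ∀ᶠ k in 𝓝 (0 : F), ‖v + k‖ < r := by
    have : ContinuousAt (fun k : F => ‖v + k‖) 0 := by fun_prop
    exact this.eventually_lt continuousAt_const (by simpa using hv)
  refine Asymptotics.IsBigO.trans_isLittleO (g := fun k : F => ‖k‖ ^ 2) ?_ ?_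
  · refine Asymptotics.IsBigO.of_bound (N * (Real.exp 1 - 1)) ?_
    filter_upwards [hev] with k hk
    have h := key k hk
    have e1 : z₀ + v + k - z₀ = v + k := by abel
    have e2 : z₀ + v - z₀ = v := by abel
    simp only [e1, e2, ContinuousLinearMap.flip_apply, norm_pow, norm_norm]
    linarith
  · have := Asymptotics.isLittleO_norm_pow_id (E' := F) (n := 2) (by norm_num)
    simpa using this

/-- Smoothness provides local bounds and a local Lipschitz constant, all below one `M`; shrinking
the radius to at most `1 / (2 * M)` gives the smallness needed on the ball. -/
theorem exists_parallel_of_flat [CompleteSpace E] {A : F → F →L[ℝ] E →L[ℝ] E} {s : Set F}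
    (hs : IsOpen s) (hA : ContDiffOn ℝ ∞ A s)
    (hflat : ∀ z ∈ s, ∀ (u v : F) (w : E),
      fderiv ℝ A z u v w + A z v (A z u w) = fderiv ℝ A z v u w + A z u (A z v w))
    {z₀ : F} (hz₀ : z₀ ∈ s) (w₀ : E) :
    ∃ W : F → E, W z₀ = w₀ ∧ ∀ᶠ z in 𝓝 z₀, HasFDerivAt W ((A z).flip (W z)) z := by
  have hA' : ContDiffOn ℝ ∞ (fderiv ℝ A) s := hA.fderiv_of_isOpen hs (by simp)
  have hs₀ := hs.mem_nhds hz₀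
  have hA'₀ : ContDiffAt ℝ 1 (fderiv ℝ A) z₀ :=
    (hA'.contDiffAt hs₀).of_le (by exact_mod_cast le_top)
  obtain ⟨K, t, ht, hK⟩ := hA'₀.exists_lipschitzOnWith
  have hcA : ContinuousAt A z₀ := (hA.contDiffAt hs₀).continuousAt
  have hcA' : ContinuousAt (fderiv ℝ A) z₀ := hA'₀.continuousAt
  set M : ℝ := K + (‖A z₀‖ + 1) + (‖fderiv ℝ A z₀‖ + 1) with hMdef
  have hM : 0 < M := by positivity
  have hev : ∀ᶠ z in 𝓝 z₀, z ∈ s ∧ z ∈ t ∧ ‖A z‖ < ‖A z₀‖ + 1 ∧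
      ‖fderiv ℝ A z‖ < ‖fderiv ℝ A z₀‖ + 1 :=
    (eventually_mem_set.2 hs₀).and ((eventually_mem_set.2 ht).and
      ((hcA.norm.eventually_lt continuousAt_const (by simp)).and
        (hcA'.norm.eventually_lt continuousAt_const (by simp))))
  obtain ⟨r₀, hr₀, hball⟩ := eventually_nhds_iff_ball.1 hev
  set r := min r₀ (1 / (2 * M)) with hrdef
  have hr : 0 < r := lt_min hr₀ (by positivity)
  have hsub : ∀ z ∈ ball z₀ r, z ∈ ball z₀ r₀ := fun z hz => ball_subset_ball (min_le_left _ _) hz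
  have hKM : (K : ℝ) ≤ M := by
    have := norm_nonneg (A z₀); have := norm_nonneg (fderiv ℝ A z₀); linarith
  obtain ⟨W, hW0, hW⟩ := exists_parallel_of_flat_ball (A := A) (A' := fderiv ℝ A) (z₀ := z₀)
    (r := r) (M := M) hr hM.le
    (by
      calc M * r ≤ M * (1 / (2 * M)) := by gcongr; exact min_le_right _ _
        _ = 1 / 2 := by field_simp)
    (fun z hz => ((hA.contDiffAt (hs.mem_nhds (hball z (hsub z hz)).1)).differentiableAt
      (by simp)).hasFDerivAt)
    (fun z hz => by
      have := (hball z (hsub z hz)).2.2.1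
      have := norm_nonneg (fderiv ℝ A z₀); have := K.2; simp only [hMdef]
      have : (0 : ℝ) ≤ K := K.2
      linarith)
    (fun z hz => by
      have := (hball z (hsub z hz)).2.2.2
      have := norm_nonneg (A z₀); simp only [hMdef]
      have : (0 : ℝ) ≤ K := K.2
      linarith)
    (fun z hz w hw => by
      have := hK.norm_sub_le (hball z (hsub z hz)).2.1 (hball w (hsub w hw)).2.1
      exact this.trans (by gcongr))
    (fun z hz => hflat z (hball z (hsub z hz)).1) w₀
  exact ⟨W, hW0, eventually_nhds_iff_ball.2 ⟨r, hr, hW⟩⟩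

/-- Bootstrapping: the equation makes the derivative of `W` as regular as `W` itself. -/
theorem contDiffOn_of_hasFDerivAt_clm {A : F → F →L[ℝ] E →L[ℝ] E} {s : Set F} (hs : IsOpen s)
    (hA : ContDiffOn ℝ ∞ A s) {W : F → E}
    (hW : ∀ z ∈ s, HasFDerivAt W ((A z).flip (W z)) z) : ContDiffOn ℝ ∞ W s := by
  have key : ∀ n : ℕ, ContDiffOn ℝ n W s := by
    intro n
    induction n with
    | zero => exact contDiffOn_zero.2 fun z hz => (hW z hz).continuousAt.continuousWithinAt
    | succ n ih =>
      rw [Nat.cast_succ, contDiffOn_succ_iff_fderiv_of_isOpen hs]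
      refine ⟨fun z hz => (hW z hz).differentiableAt.differentiableWithinAt, by simp, ?_⟩
      have hA' : ContDiffOn ℝ n A s := contDiffOn_infty.1 hA n
      have h1 : ContDiffOn ℝ n (fun z => (A z).flip (W z)) s :=
        ((ContinuousLinearMap.flipₗᵢ ℝ F E E).contDiff.comp_contDiffOn hA').clm_apply ih
      exact h1.congr fun z hz => (hW z hz).fderiv
  exact contDiffOn_infty.2 key

end Frobenius

/-! ### Hessian systems: integrability, solutions and quotients -/

section LinearSystem

set_option maxSynthPendingDepth 3

/-- The linear form on the plane with the given partial derivatives. -/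
def planeForm (p q : ℝ) : ℝ × ℝ →L[ℝ] ℝ :=
  p • ContinuousLinearMap.fst ℝ ℝ ℝ + q • ContinuousLinearMap.snd ℝ ℝ ℝ

@[simp] theorem planeForm_apply (p q : ℝ) (v : ℝ × ℝ) : planeForm p q v = p * v.1 + q * v.2 := by
  simp [planeForm]

theorem fderiv_apply_eq_partials (k : ℝ × ℝ → ℝ) (z u : ℝ × ℝ) :
    fderiv ℝ k z u = partialX k z * u.1 + partialY k z * u.2 := by
  have : u = u.1 • ((1, 0) : ℝ × ℝ) + u.2 • ((0, 1) : ℝ × ℝ) := by ext <;> simp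
  conv_lhs => rw [this]
  rw [map_add, map_smul, map_smul, partialX, partialY]
  simp [mul_comm]

theorem HasFDerivAt.partialX_eq {k : ℝ × ℝ → ℝ} {p q : ℝ} {z : ℝ × ℝ}
    (h : HasFDerivAt k (planeForm p q) z) : partialX k z = p := by
  simp [partialX, h.fderiv]

theorem HasFDerivAt.partialY_eq {k : ℝ × ℝ → ℝ} {p q : ℝ} {z : ℝ × ℝ}
    (h : HasFDerivAt k (planeForm p q) z) : partialY k z = q := by
  simp [partialY, h.fderiv]

/-- The function `s` with partial derivatives `s₁`, `s₂` solves the linear system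
`s_xx + a s_x + d s_y + P s = 0`, `s_xy + b s_x + e s_y + Q s = 0`,
`s_yy + c s_x + f s_y + R s = 0` on `V`. -/
structure IsHessianSolution (V : Set (ℝ × ℝ)) (a b c d e f P Q R s s₁ s₂ : ℝ × ℝ → ℝ) :
    Prop where
  hasFDerivAt : ∀ z ∈ V, HasFDerivAt s (planeForm (s₁ z) (s₂ z)) z
  hasFDerivAt_fst : ∀ z ∈ V, HasFDerivAt s₁
    (planeForm (-(a z * s₁ z + d z * s₂ z + P z * s z))
      (-(b z * s₁ z + e z * s₂ z + Q z * s z))) z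
  hasFDerivAt_snd : ∀ z ∈ V, HasFDerivAt s₂
    (planeForm (-(b z * s₁ z + e z * s₂ z + Q z * s z))
      (-(c z * s₁ z + f z * s₂ z + R z * s z))) z

theorem IsHessianSolution.mono {V V' : Set (ℝ × ℝ)} {a b c d e f P Q R s s₁ s₂ : ℝ × ℝ → ℝ}
    (h : IsHessianSolution V a b c d e f P Q R s s₁ s₂) (hV : V' ⊆ V) :
    IsHessianSolution V' a b c d e f P Q R s s₁ s₂ :=
  ⟨fun z hz => h.hasFDerivAt z (hV hz), fun z hz => h.hasFDerivAt_fst z (hV hz),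
    fun z hz => h.hasFDerivAt_snd z (hV hz)⟩

/-- The integrability conditions of the linear system of `IsHessianSolution`. -/
structure IsFlatHessianSystem (U : Set (ℝ × ℝ)) (a b c d e f P Q R : ℝ × ℝ → ℝ) : Prop where
  smooth_a : ContDiffOn ℝ ∞ a U
  smooth_b : ContDiffOn ℝ ∞ b U
  smooth_c : ContDiffOn ℝ ∞ c U
  smooth_d : ContDiffOn ℝ ∞ d U
  smooth_e : ContDiffOn ℝ ∞ e U
  smooth_f : ContDiffOn ℝ ∞ f U
  smooth_P : ContDiffOn ℝ ∞ P U
  smooth_Q : ContDiffOn ℝ ∞ Q U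
  smooth_R : ContDiffOn ℝ ∞ R U
  xxy_x : ∀ z ∈ U, partialY a z - partialX b z + e z * b z - d z * c z - Q z = 0
  xxy_y : ∀ z ∈ U, partialY d z - partialX e z + b z * d z + e z ^ 2 - a z * e z - d z * f z
    + P z = 0
  xxy : ∀ z ∈ U, partialX Q z - partialY P z + a z * Q z + d z * R z - b z * P z - e z * Q z = 0
  xyy_x : ∀ z ∈ U, partialY b z - partialX c z + c z * a z + f z * b z - b z ^ 2 - e z * c z
    - R z = 0
  xyy_y : ∀ z ∈ U, partialX f z - partialY e z + b z * e z - c z * d z - Q z = 0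
  xyy : ∀ z ∈ U, partialX R z - partialY Q z + b z * Q z + e z * R z - c z * P z - f z * Q z = 0

set_option maxHeartbeats 1000000 in
-- The 1-jet (s, s_x, s_y) satisfies a first-order linear system. Its curvature vanishes precisely
-- when the two ways of computing s_xxy, and of s_xyy, agree in the coefficients of s_x, s_y and s;
-- these are the six conditions. Any initial 1-jet is then attained.
theorem IsFlatHessianSystem.exists_solution {U : Set (ℝ × ℝ)} (hU : IsOpen U)
    {a b c d e f P Q R : ℝ × ℝ → ℝ} (h : IsFlatHessianSystem U a b c d e f P Q R)
    {z₀ : ℝ × ℝ} (hz₀ : z₀ ∈ U) (w₀ w₁ w₂ : ℝ) :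
    ∃ V, IsOpen V ∧ z₀ ∈ V ∧ V ⊆ U ∧ ∃ s s₁ s₂ : ℝ × ℝ → ℝ,
      s z₀ = w₀ ∧ s₁ z₀ = w₁ ∧ s₂ z₀ = w₂ ∧
      ContDiffOn ℝ ∞ s V ∧ ContDiffOn ℝ ∞ s₁ V ∧ ContDiffOn ℝ ∞ s₂ V ∧
      IsHessianSolution V a b c d e f P Q R s s₁ s₂ := by
  let dx := ContinuousLinearMap.fst ℝ ℝ ℝ
  let dy := ContinuousLinearMap.snd ℝ ℝ ℝ
  let p₀ := ContinuousLinearMap.fst ℝ ℝ (ℝ × ℝ)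
  let p₁ := dx.comp (ContinuousLinearMap.snd ℝ ℝ (ℝ × ℝ))
  let p₂ := dy.comp (ContinuousLinearMap.snd ℝ ℝ (ℝ × ℝ))
  let T (l : ℝ × ℝ →L[ℝ] ℝ) (p : ℝ × ℝ × ℝ →L[ℝ] ℝ) (v : ℝ × ℝ × ℝ) :
    ℝ × ℝ →L[ℝ] (ℝ × ℝ × ℝ) →L[ℝ] ℝ × ℝ × ℝ := l.smulRight (p.smulRight v)
  let ε₀ : ℝ × ℝ × ℝ := (1, 0, 0)
  let ε₁ : ℝ × ℝ × ℝ := (0, 1, 0)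
  let ε₂ : ℝ × ℝ × ℝ := (0, 0, 1)
  -- `S`, `S'`, `S''` place s_xx, s_xy, s_yy in the differential of the jet; s_xy occurs in both
  -- ds_x and ds_y.
  let S (p : ℝ × ℝ × ℝ →L[ℝ] ℝ) := T dx p ε₁
  let S' (p : ℝ × ℝ × ℝ →L[ℝ] ℝ) := T dy p ε₁ + T dx p ε₂
  let S'' (p : ℝ × ℝ × ℝ →L[ℝ] ℝ) := T dy p ε₂
  let A : ℝ × ℝ → ℝ × ℝ →L[ℝ] (ℝ × ℝ × ℝ) →L[ℝ] ℝ × ℝ × ℝ := fun z =>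
    T dx p₁ ε₀ + T dy p₂ ε₀ - (a z • S p₁ + d z • S p₂ + P z • S p₀)
      - (b z • S' p₁ + e z • S' p₂ + Q z • S' p₀)
      - (c z • S'' p₁ + f z • S'' p₂ + R z • S'' p₀)
  have hsm : ContDiffOn ℝ ∞ A U := by
    have h1 := h.smooth_a
    have h2 := h.smooth_b
    have h3 := h.smooth_c
    have h4 := h.smooth_d
    have h5 := h.smooth_e
    have h6 := h.smooth_f
    have h7 := h.smooth_P
    have h8 := h.smooth_Q
    have h9 := h.smooth_R
    simp only [A]
    fun_prop
  have hdiff : ∀ {k : ℝ × ℝ → ℝ}, ContDiffOn ℝ ∞ k U → ∀ z ∈ U,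
      HasFDerivAt k (fderiv ℝ k z) z := fun hk z hz =>
    ((hk.contDiffAt (hU.mem_nhds hz)).differentiableAt (by simp)).hasFDerivAt
  have hflat : ∀ z ∈ U, ∀ (u v : ℝ × ℝ) (w : ℝ × ℝ × ℝ),
      fderiv ℝ A z u v w + A z v (A z u w) = fderiv ℝ A z v u w + A z u (A z v w) := by
    intro z hz u v w
    have hd := ((((hasFDerivAt_const (T dx p₁ ε₀ + T dy p₂ ε₀) z).sub
      ((((hdiff h.smooth_a z hz).smul_const (S p₁)).add
        ((hdiff h.smooth_d z hz).smul_const (S p₂))).add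
        ((hdiff h.smooth_P z hz).smul_const (S p₀)))).sub
      ((((hdiff h.smooth_b z hz).smul_const (S' p₁)).add
        ((hdiff h.smooth_e z hz).smul_const (S' p₂))).add
        ((hdiff h.smooth_Q z hz).smul_const (S' p₀)))).sub
      ((((hdiff h.smooth_c z hz).smul_const (S'' p₁)).add
        ((hdiff h.smooth_f z hz).smul_const (S'' p₂))).add
        ((hdiff h.smooth_R z hz).smul_const (S'' p₀))))
    have hd' : fderiv ℝ A z = _ := hd.fderiv
    rw [hd']
    have e1 := h.xxy_x z hz
    have e2 := h.xxy_y z hz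
    have e3 := h.xxy z hz
    have e4 := h.xyy_x z hz
    have e5 := h.xyy_y z hz
    have e6 := h.xyy z hz
    ext
    -- The s-component is automatic, because the prescribed Hessian is symmetric.
    · simp [A, S, S', S'', T, dx, dy, p₀, p₁, p₂, ε₀, ε₁, ε₂]
      ring
    · simp [A, S, S', S'', T, dx, dy, p₀, p₁, p₂, ε₀, ε₁, ε₂, fderiv_apply_eq_partials]
      linear_combination (u.1 * v.2 - u.2 * v.1) * (w.2.1 * e1 + w.2.2 * e2 - w.1 * e3)
    · simp [A, S, S', S'', T, dx, dy, p₀, p₁, p₂, ε₀, ε₁, ε₂, fderiv_apply_eq_partials]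
      linear_combination (u.1 * v.2 - u.2 * v.1) * (w.2.1 * e4 - w.2.2 * e5 - w.1 * e6)
  obtain ⟨W, hW0, hW⟩ := exists_parallel_of_flat hU hsm hflat hz₀ (w₀, w₁, w₂)
  obtain ⟨V, hVW, hV, hzV⟩ := eventually_nhds_iff.1 (hW.and (hU.eventually_mem hz₀))
  have hWs := contDiffOn_of_hasFDerivAt_clm hV (hsm.mono fun z hz => (hVW z hz).2)
    (fun z hz => (hVW z hz).1)
  refine ⟨V, hV, hzV, fun z hz => (hVW z hz).2, fun z => p₀ (W z), fun z => p₁ (W z),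
    fun z => p₂ (W z), by simp [p₀, hW0], by simp [p₁, dx, hW0], by simp [p₂, dy, hW0],
    p₀.contDiff.comp_contDiffOn hWs, p₁.contDiff.comp_contDiffOn hWs,
    p₂.contDiff.comp_contDiffOn hWs, ⟨fun z hz => ?_, fun z hz => ?_, fun z hz => ?_⟩⟩
  · refine (p₀.hasFDerivAt.comp z (hVW z hz).1).congr_fderiv ?_
    ext <;> simp [A, S, S', S'', T, dx, dy, p₀, p₁, p₂, ε₀, ε₁, ε₂]
  · refine (p₁.hasFDerivAt.comp z (hVW z hz).1).congr_fderiv ?_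
    ext <;> simp [A, S, S', S'', T, dx, dy, p₀, p₁, p₂, ε₀, ε₁, ε₂]
  · refine (p₂.hasFDerivAt.comp z (hVW z hz).1).congr_fderiv ?_
    ext <;> simp [A, S, S', S'', T, dx, dy, p₀, p₁, p₂, ε₀, ε₁, ε₂]

theorem HasFDerivAt.planeForm_mul {k l : ℝ × ℝ → ℝ} {p q p' q' : ℝ} {z : ℝ × ℝ}
    (hk : HasFDerivAt k (planeForm p q) z) (hl : HasFDerivAt l (planeForm p' q') z) :
    HasFDerivAt (fun w => k w * l w)
      (planeForm (p * l z + k z * p') (q * l z + k z * q')) z := by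
  refine (hk.mul hl).congr_fderiv ?_
  ext <;> simp <;> ring

theorem HasFDerivAt.planeForm_sub {k l : ℝ × ℝ → ℝ} {p q p' q' : ℝ} {z : ℝ × ℝ}
    (hk : HasFDerivAt k (planeForm p q) z) (hl : HasFDerivAt l (planeForm p' q') z) :
    HasFDerivAt (fun w => k w - l w) (planeForm (p - p') (q - q')) z := by
  refine (hk.sub hl).congr_fderiv ?_
  ext <;> simp

theorem HasFDerivAt.planeForm_div {k l : ℝ × ℝ → ℝ} {p q p' q' : ℝ} {z : ℝ × ℝ}
    (hk : HasFDerivAt k (planeForm p q) z) (hl : HasFDerivAt l (planeForm p' q') z)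
    (h0 : l z ≠ 0) :
    HasFDerivAt (fun w => k w / l w) (planeForm ((p * l z - k z * p') / l z ^ 2)
      ((q * l z - k z * q') / l z ^ 2)) z := by
  have hinv := (hasDerivAt_inv h0).comp_hasFDerivAt z hl
  refine (hk.mul hinv).congr_fderiv ?_
  ext <;> simp <;> field_simp <;> ring

/-- Substitute t = sτ. The potentials cancel because s and t solve the same system, and the cross
terms of ds and dτ are absorbed into the connection. This change is projective: c, d, a - 2e and f -
2b are unaffected. -/
theorem IsHessianSolution.div {V : Set (ℝ × ℝ)} {a b c d e f P Q R s s₁ s₂ t t₁ t₂ : ℝ × ℝ → ℝ}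
    (hs : IsHessianSolution V a b c d e f P Q R s s₁ s₂)
    (ht : IsHessianSolution V a b c d e f P Q R t t₁ t₂) (hne : ∀ z ∈ V, s z ≠ 0) :
    IsHessianSolution V (fun z => a z + 2 * (s₁ z / s z)) (fun z => b z + s₂ z / s z) c d
      (fun z => e z + s₁ z / s z) (fun z => f z + 2 * (s₂ z / s z)) 0 0 0
      (fun z => t z / s z) (fun z => (t₁ z * s z - t z * s₁ z) / s z ^ 2)
      (fun z => (t₂ z * s z - t z * s₂ z) / s z ^ 2) := by
  refine ⟨fun z hz => ?_, fun z hz => ?_, fun z hz => ?_⟩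
  · exact (ht.hasFDerivAt z hz).planeForm_div (hs.hasFDerivAt z hz) (hne z hz)
  · have h0 := hne z hz
    have h2 := (hs.hasFDerivAt z hz).planeForm_mul (hs.hasFDerivAt z hz)
    simp only [sq]
    refine ((((ht.hasFDerivAt_fst z hz).planeForm_mul (hs.hasFDerivAt z hz)).planeForm_sub
      ((ht.hasFDerivAt z hz).planeForm_mul (hs.hasFDerivAt_fst z hz))).planeForm_div
      h2 (mul_ne_zero h0 h0)).congr_fderiv ?_
    congr 1 <;> simp <;> field_simp <;> ring
  · have h0 := hne z hz
    have h2 := (hs.hasFDerivAt z hz).planeForm_mul (hs.hasFDerivAt z hz)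
    simp only [sq]
    refine ((((ht.hasFDerivAt_snd z hz).planeForm_mul (hs.hasFDerivAt z hz)).planeForm_sub
      ((ht.hasFDerivAt z hz).planeForm_mul (hs.hasFDerivAt_snd z hz))).planeForm_div
      h2 (mul_ne_zero h0 h0)).congr_fderiv ?_
    congr 1 <;> simp <;> field_simp <;> ring

end LinearSystem

/-! ### Straightening the unparametrized geodesics -/

section PointTransformation

open Filter Topology

/-- Uniqueness against the zero solution: the coefficient is bounded on the compact interval between
`t₀` and `t`, on either side. -/
theorem eqOn_zero_of_linear_ode {I : Set ℝ} (hI : I.OrdConnected) {k w : ℝ → ℝ}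
    (hk : ContinuousOn k I) (hw : ∀ t ∈ I, HasDerivAt w (k t * w t) t) {t₀ : ℝ} (ht₀ : t₀ ∈ I)
    (h0 : w t₀ = 0) : ∀ t ∈ I, w t = 0 := by
  intro t ht
  have hsub : uIcc t₀ t ⊆ I := hI.uIcc_subset ht₀ ht
  obtain ⟨C, hC⟩ := isCompact_uIcc.exists_bound_of_continuousOn (hk.mono hsub)
  have hlip : ∀ s ∈ uIcc t₀ t, LipschitzOnWith C.toNNReal (fun x : ℝ => k s * x) univ := by
    intro s hs
    refine LipschitzOnWith.of_dist_le_mul fun x _ y _ => ?_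
    rw [Real.dist_eq, Real.dist_eq, ← mul_sub, abs_mul]
    exact mul_le_mul_of_nonneg_right ((hC s hs).trans (Real.le_coe_toNNReal C)) (abs_nonneg _)
  have hcont : ContinuousOn w (uIcc t₀ t) := fun s hs =>
    (hw s (hsub hs)).continuousAt.continuousWithinAt
  have hz : ∀ s, HasDerivAt (fun _ : ℝ => (0 : ℝ)) (k s * 0) s := fun s => by
    simpa using hasDerivAt_const s (0 : ℝ)
  rcases le_total t₀ t with h | h
  · rw [uIcc_of_le h] at hlip hcont hsub
    exact ODE_solution_unique_of_mem_Icc_right (fun s hs => hlip s (Ico_subset_Icc_self hs)) hcont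
      (fun s hs => (hw s (hsub (Ico_subset_Icc_self hs))).hasDerivWithinAt) (fun _ _ => mem_univ _)
      continuousOn_const (fun s _ => (hz s).hasDerivWithinAt) (fun _ _ => mem_univ _) h0
      ⟨h, le_rfl⟩
  · rw [uIcc_of_ge h] at hlip hcont hsub
    exact ODE_solution_unique_of_mem_Icc_left (fun s hs => hlip s (Ioc_subset_Icc_self hs)) hcont
      (fun s hs => (hw s (hsub (Ioc_subset_Icc_self hs))).hasDerivWithinAt) (fun _ _ => mem_univ _)
      continuousOn_const (fun s _ => (hz s).hasDerivWithinAt) (fun _ _ => mem_univ _) h0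
      ⟨le_rfl, h⟩

theorem HasFDerivAt.hasDerivAt_graph {k : ℝ × ℝ → ℝ} {p q t y' : ℝ} {y : ℝ → ℝ}
    (hk : HasFDerivAt k (planeForm p q) (t, y t)) (hy : HasDerivAt y y' t) :
    HasDerivAt (fun s => k (s, y s)) (p + y' * q) t := by
  have := HasFDerivAt.comp_hasDerivAt t hk ((hasDerivAt_id t).prodMk hy)
  refine this.congr_deriv ?_
  simp [mul_comm]

theorem IsHessianSolution.linear_comb {V : Set (ℝ × ℝ)}
    {a b c d e f s s₁ s₂ t t₁ t₂ : ℝ × ℝ → ℝ}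
    (hs : IsHessianSolution V a b c d e f 0 0 0 s s₁ s₂)
    (ht : IsHessianSolution V a b c d e f 0 0 0 t t₁ t₂) (α β : ℝ) :
    IsHessianSolution V a b c d e f 0 0 0 (fun z => α * s z + β * t z)
      (fun z => α * s₁ z + β * t₁ z) (fun z => α * s₂ z + β * t₂ z) := by
  refine ⟨fun z hz => ?_, fun z hz => ?_, fun z hz => ?_⟩
  · refine (((hs.hasFDerivAt z hz).const_mul α).add
      ((ht.hasFDerivAt z hz).const_mul β)).congr_fderiv ?_
    ext <;> simp
  · refine (((hs.hasFDerivAt_fst z hz).const_mul α).add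
      ((ht.hasFDerivAt_fst z hz).const_mul β)).congr_fderiv ?_
    ext <;> simp <;> ring
  · refine (((hs.hasFDerivAt_snd z hz).const_mul α).add
      ((ht.hasFDerivAt_snd z hz).const_mul β)).congr_fderiv ?_
    ext <;> simp <;> ring

/-- Functions with vanishing covariant Hessian along the graph of a function. -/
theorem IsHessianSolution.hasDerivAt_deriv_graph {V : Set (ℝ × ℝ)}
    {a b c d e f s s₁ s₂ : ℝ × ℝ → ℝ} (hs : IsHessianSolution V a b c d e f 0 0 0 s s₁ s₂)
    {t y' y'' : ℝ} {y v : ℝ → ℝ} (hV : (t, y t) ∈ V) (hy : HasDerivAt y y' t)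
    (hv : HasDerivAt v y'' t) (hvy : v t = y') :
    HasDerivAt (fun r => s₁ (r, y r) + v r * s₂ (r, y r))
      (-(a (t, y t) + 2 * b (t, y t) * y' + c (t, y t) * y' ^ 2)
          * (s₁ (t, y t) + y' * s₂ (t, y t))
        + (y'' + (c (t, y t) * y' ^ 3 - (f (t, y t) - 2 * b (t, y t)) * y' ^ 2
          + (a (t, y t) - 2 * e (t, y t)) * y' - d (t, y t))) * s₂ (t, y t)) t := by
  -- After substituting the Hessian equations, replace s_x by w - y' s_y, with w the total
  -- derivative; the coefficient of s_y becomes y'' plus the cubic.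
  refine (((hs.hasFDerivAt_fst _ hV).hasDerivAt_graph hy).add
    (hv.mul ((hs.hasFDerivAt_snd _ hV).hasDerivAt_graph hy))).congr_deriv ?_
  simp [hvy]
  ring

theorem IsCurveIn.hasDerivAt {V : Set (ℝ × ℝ)} {I : Set ℝ} {y : ℝ → ℝ} (h : IsCurveIn V I y)
    {t : ℝ} (ht : t ∈ I) : HasDerivAt y (deriv y t) t :=
  ((h.contDiffOn.contDiffAt (h.isOpen.mem_nhds ht)).differentiableAt (by simp)).hasDerivAt

theorem IsCurveIn.hasDerivAt_deriv {V : Set (ℝ × ℝ)} {I : Set ℝ} {y : ℝ → ℝ}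
    (h : IsCurveIn V I y) {t : ℝ} (ht : t ∈ I) :
    HasDerivAt (deriv y) (deriv (deriv y) t) t := by
  have h1 : ContDiffOn ℝ 1 (deriv y) I :=
    h.contDiffOn.deriv_of_isOpen h.isOpen (by norm_num)
  exact ((h1.contDiffAt (h.isOpen.mem_nhds ht)).differentiableAt (by simp)).hasDerivAt

/-- A pair of affine coordinates of a connection straightens the unparametrized geodesics. -/
theorem solvesSecondOrder_iff_image_in_line {V : Set (ℝ × ℝ)}
    {a b c d e f φ φ₁ φ₂ ψ ψ₁ ψ₂ : ℝ × ℝ → ℝ}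
    (hφ : IsHessianSolution V a b c d e f 0 0 0 φ φ₁ φ₂)
    (hψ : IsHessianSolution V a b c d e f 0 0 0 ψ ψ₁ ψ₂)
    (hJ : ∀ z ∈ V, φ₁ z * ψ₂ z - φ₂ z * ψ₁ z ≠ 0)
    (ha : ContinuousOn a V) (hb : ContinuousOn b V) (hc : ContinuousOn c V)
    {G : ℝ × ℝ × ℝ → ℝ}
    (hG : ∀ x y p, (x, y) ∈ V → G (x, y, p) = c (x, y) * p ^ 3
      - (f (x, y) - 2 * b (x, y)) * p ^ 2 + (a (x, y) - 2 * e (x, y)) * p - d (x, y))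
    {I : Set ℝ} {y : ℝ → ℝ} (hy : IsCurveIn V I y) :
    SolvesSecondOrder G I y ↔
      ∃ α β γ : ℝ, (α, β) ≠ (0, 0) ∧ ∀ t ∈ I, α * φ (t, y t) + β * ψ (t, y t) = γ := by
  have hL1 : ∀ α β : ℝ, ∀ t ∈ I, HasDerivAt (fun r => α * φ (r, y r) + β * ψ (r, y r))
      ((α * φ₁ (t, y t) + β * ψ₁ (t, y t))
        + deriv y t * (α * φ₂ (t, y t) + β * ψ₂ (t, y t))) t := fun α β t ht =>
    ((hφ.linear_comb hψ α β).hasFDerivAt _ (hy.graph_mem t ht)).hasDerivAt_graph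
      (hy.hasDerivAt ht)
  have hL2 := fun (α β t : ℝ) (ht : t ∈ I) =>
    (hφ.linear_comb hψ α β).hasDerivAt_deriv_graph (hy.graph_mem t ht)
      (hy.hasDerivAt ht) (hy.hasDerivAt_deriv ht) rfl
  constructor
  · intro hsol
    rcases I.eq_empty_or_nonempty with rfl | ⟨t₀, ht₀⟩
    · exact ⟨1, 0, 0, by simp, by simp⟩
    -- The line is the tangent at `t₀` to the image curve: with these weights the derivative of αφ +
    -- βψ along the graph vanishes there, hence everywhere by uniqueness.
    set α := ψ₁ (t₀, y t₀) + deriv y t₀ * ψ₂ (t₀, y t₀) with hα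
    set β := -(φ₁ (t₀, y t₀) + deriv y t₀ * φ₂ (t₀, y t₀)) with hβ
    have hcurve : ContinuousOn (fun t => (t, y t)) I :=
      continuousOn_id.prodMk hy.contDiffOn.continuousOn
    have hmaps : MapsTo (fun t => (t, y t)) I V := hy.graph_mem
    have hy' : ContinuousOn (deriv y) I := fun t ht =>
      (hy.hasDerivAt_deriv ht).continuousAt.continuousWithinAt
    have hzero := eqOn_zero_of_linear_ode hy.ordConnected
      (k := fun t => -(a (t, y t) + 2 * b (t, y t) * deriv y t + c (t, y t) * deriv y t ^ 2))
      (w := fun t => (α * φ₁ (t, y t) + β * ψ₁ (t, y t))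
        + deriv y t * (α * φ₂ (t, y t) + β * ψ₂ (t, y t)))
      ((((ha.comp hcurve hmaps).add ((continuousOn_const.mul (hb.comp hcurve hmaps)).mul
        hy')).add ((hc.comp hcurve hmaps).mul (hy'.pow 2))).neg)
      (fun t ht => by
        refine (hL2 α β t ht).congr_deriv ?_
        have := hsol t ht
        rw [hG _ _ _ (hy.graph_mem t ht)] at this
        rw [this]
        ring) ht₀ (by simp only [hα, hβ]; ring)
    refine ⟨α, β, α * φ (t₀, y t₀) + β * ψ (t₀, y t₀), fun h0 => ?_, fun t ht => ?_⟩
    · rw [Prod.mk.injEq] at h0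
      -- Otherwise the Jacobian matrix would annihilate the tangent vector (1, y').
      refine hJ _ (hy.graph_mem t₀ ht₀) ?_
      obtain ⟨h1, h2⟩ := h0
      linear_combination φ₂ (t₀, y t₀) * (-h1) - ψ₂ (t₀, y t₀) * h2
    · exact hy.isOpen.is_const_of_deriv_eq_zero hy.ordConnected.isPreconnected
        (f := fun r => α * φ (r, y r) + β * ψ (r, y r))
        (fun t ht => (hL1 α β t ht).differentiableAt.differentiableWithinAt)
        (fun t ht => (hL1 α β t ht).deriv.trans (hzero t ht)) ht ht₀
  · rintro ⟨α, β, γ, hne, hline⟩ t ht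
    have hev : ∀ t ∈ I, ∀ᶠ r in 𝓝 t, r ∈ I := fun t ht => hy.isOpen.mem_nhds ht
    have hzero : ∀ t ∈ I, (α * φ₁ (t, y t) + β * ψ₁ (t, y t))
        + deriv y t * (α * φ₂ (t, y t) + β * ψ₂ (t, y t)) = 0 := fun t ht =>
      (hL1 α β t ht).unique ((hasDerivAt_const t γ).congr_of_eventuallyEq
        ((hev t ht).mono fun r hr => hline r hr))
    have h2 := (hL2 α β t ht).unique ((hasDerivAt_const t (0 : ℝ)).congr_of_eventuallyEq
        ((hev t ht).mono fun r hr => hzero r hr))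
    have hz := hzero t ht
    rw [hz, mul_zero, zero_add, ← hG _ _ _ (hy.graph_mem t ht)] at h2
    -- In the second case both partial derivatives of αφ + βψ vanish at the point, contradicting the
    -- Jacobian condition.
    rcases mul_eq_zero.1 h2 with h | h
    · exact h
    · refine absurd ?_ hne
      rw [h, mul_zero, add_zero] at hz
      have hj := hJ _ (hy.graph_mem t ht)
      rw [Prod.mk.injEq]
      constructor
      · refine (mul_eq_zero.1 ?_).resolve_right hj
        linear_combination ψ₂ (t, y t) * hz - ψ₁ (t, y t) * h
      · refine (mul_eq_zero.1 ?_).resolve_right hj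
        linear_combination φ₁ (t, y t) * h - φ₂ (t, y t) * hz

theorem exists_isOpen_injOn_of_hasFDerivAt_id {Φ : ℝ × ℝ → ℝ × ℝ} {z₀ : ℝ × ℝ}
    (hΦ : ContDiffAt ℝ 1 Φ z₀) (hd : HasFDerivAt Φ (ContinuousLinearMap.id ℝ (ℝ × ℝ)) z₀) :
    ∃ V, IsOpen V ∧ z₀ ∈ V ∧ InjOn Φ V := by
  have hs : HasStrictFDerivAt Φ
      (ContinuousLinearEquiv.refl ℝ (ℝ × ℝ) : ℝ × ℝ →L[ℝ] ℝ × ℝ) z₀ := by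
    have := hΦ.hasStrictFDerivAt' hd (by simp)
    simpa using this
  exact ⟨(hs.toOpenPartialHomeomorph Φ).source, (hs.toOpenPartialHomeomorph Φ).open_source,
    hs.mem_toOpenPartialHomeomorph_source, (hs.toOpenPartialHomeomorph Φ).injOn⟩

/-- Solutions `s`, `t`, `r` with 1-jets (1,0,0), (0,1,0), (0,0,1) at the point make (t/s, r/s) a map
with identity differential there, so it is a point transformation nearby. -/
theorem IsFlatHessianSystem.pointLinearizable {U : Set (ℝ × ℝ)} (hU : IsOpen U)
    {a b c d e f P Q R : ℝ × ℝ → ℝ} (h : IsFlatHessianSystem U a b c d e f P Q R)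
    {G : ℝ × ℝ × ℝ → ℝ}
    (hG : ∀ x y p, (x, y) ∈ U → G (x, y, p) = c (x, y) * p ^ 3
      - (f (x, y) - 2 * b (x, y)) * p ^ 2 + (a (x, y) - 2 * e (x, y)) * p - d (x, y)) :
    PointLinearizable U G := by
  intro z₀ hz₀
  obtain ⟨Vs, hVs, hzs, hVsU, s, s₁, s₂, hs0, hs10, hs20, hss, hss₁, hss₂, hs⟩ :=
    h.exists_solution hU hz₀ 1 0 0
  obtain ⟨Vt, hVt, hzt, hVtU, t, t₁, t₂, ht0, ht10, ht20, hts, hts₁, hts₂, ht⟩ :=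
    h.exists_solution hU hz₀ 0 1 0
  obtain ⟨Vr, hVr, hzr, hVrU, r, r₁, r₂, hr0, hr10, hr20, hrs, hrs₁, hrs₂, hr⟩ :=
    h.exists_solution hU hz₀ 0 0 1
  set φ : ℝ × ℝ → ℝ := fun z => t z / s z
  set ψ : ℝ × ℝ → ℝ := fun z => r z / s z
  set φ₁ : ℝ × ℝ → ℝ := fun z => (t₁ z * s z - t z * s₁ z) / s z ^ 2
  set φ₂ : ℝ × ℝ → ℝ := fun z => (t₂ z * s z - t z * s₂ z) / s z ^ 2
  set ψ₁ : ℝ × ℝ → ℝ := fun z => (r₁ z * s z - r z * s₁ z) / s z ^ 2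
  set ψ₂ : ℝ × ℝ → ℝ := fun z => (r₂ z * s z - r z * s₂ z) / s z ^ 2
  have hev : ∀ᶠ z in 𝓝 z₀, z ∈ Vs ∧ z ∈ Vt ∧ z ∈ Vr ∧ s z ≠ 0 :=
    (hVs.eventually_mem hzs).and ((hVt.eventually_mem hzt).and ((hVr.eventually_mem hzr).and
      ((hss.continuousOn.continuousAt (hVs.mem_nhds hzs)).eventually_ne (by simp [hs0]))))
  obtain ⟨V₁, hV₁, hV₁o, hzV₁⟩ := eventually_nhds_iff.1 hev
  have hne : ∀ z ∈ V₁, s z ≠ 0 := fun z hz => (hV₁ z hz).2.2.2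
  have hsV : V₁ ⊆ Vs := fun z hz => (hV₁ z hz).1
  have htV : V₁ ⊆ Vt := fun z hz => (hV₁ z hz).2.1
  have hrV : V₁ ⊆ Vr := fun z hz => (hV₁ z hz).2.2.1
  have hφ := (hs.mono hsV).div (ht.mono htV) hne
  have hψ := (hs.mono hsV).div (hr.mono hrV) hne
  have hφs : ContDiffOn ℝ ∞ φ V₁ := (hts.mono htV).div (hss.mono hsV) hne
  have hψs : ContDiffOn ℝ ∞ ψ V₁ := (hrs.mono hrV).div (hss.mono hsV) hne
  have hq : ∀ {k k' : ℝ × ℝ → ℝ}, ContinuousOn k V₁ → ContinuousOn k' V₁ →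
      ∀ {l : ℝ × ℝ → ℝ}, ContinuousOn l V₁ →
      ContinuousOn (fun z => (k z * s z - l z * k' z) / s z ^ 2) V₁ := fun hk hk' _ hl =>
    ((hk.mul (hss.mono hsV).continuousOn).sub (hl.mul hk')).div
      ((hss.mono hsV).continuousOn.pow 2) fun z hz => pow_ne_zero 2 (hne z hz)
  have hs₁c := (hss₁.mono hsV).continuousOn
  have hs₂c := (hss₂.mono hsV).continuousOn
  have hφ₁c : ContinuousOn φ₁ V₁ :=
    hq (hts₁.mono htV).continuousOn hs₁c (hts.mono htV).continuousOn
  have hφ₂c : ContinuousOn φ₂ V₁ :=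
    hq (hts₂.mono htV).continuousOn hs₂c (hts.mono htV).continuousOn
  have hψ₁c : ContinuousOn ψ₁ V₁ :=
    hq (hrs₁.mono hrV).continuousOn hs₁c (hrs.mono hrV).continuousOn
  have hψ₂c : ContinuousOn ψ₂ V₁ :=
    hq (hrs₂.mono hrV).continuousOn hs₂c (hrs.mono hrV).continuousOn
  have hJc : ContinuousAt (fun z => φ₁ z * ψ₂ z - φ₂ z * ψ₁ z) z₀ :=
    ((hφ₁c.mul hψ₂c).sub (hφ₂c.mul hψ₁c)).continuousAt (hV₁o.mem_nhds hzV₁)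
  have hφ₁0 : φ₁ z₀ = 1 := by simp [φ₁, *]
  have hφ₂0 : φ₂ z₀ = 0 := by simp [φ₂, *]
  have hψ₁0 : ψ₁ z₀ = 0 := by simp [ψ₁, *]
  have hψ₂0 : ψ₂ z₀ = 1 := by simp [ψ₂, *]
  obtain ⟨V₂, hV₂o, hzV₂, hinj⟩ := exists_isOpen_injOn_of_hasFDerivAt_id
    (Φ := fun z => (φ z, ψ z)) (z₀ := z₀)
    (((hφs.prodMk hψs).contDiffAt (hV₁o.mem_nhds hzV₁)).of_le (by simp))
    (by
      refine ((hφ.hasFDerivAt z₀ hzV₁).prodMk (hψ.hasFDerivAt z₀ hzV₁)).congr_fderiv ?_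
      change (planeForm (φ₁ z₀) (φ₂ z₀)).prod (planeForm (ψ₁ z₀) (ψ₂ z₀)) = _
      rw [hφ₁0, hφ₂0, hψ₁0, hψ₂0]
      ext <;> simp)
  obtain ⟨V₃, hV₃, hV₃o, hzV₃⟩ := eventually_nhds_iff.1
    (hJc.eventually_ne (by simp [hφ₁0, hφ₂0, hψ₁0, hψ₂0] : _ ≠ (0 : ℝ)))
  have hsub : V₁ ∩ V₂ ∩ V₃ ⊆ V₁ := fun z hz => hz.1.1
  have hJ : ∀ z ∈ V₁ ∩ V₂ ∩ V₃, φ₁ z * ψ₂ z - φ₂ z * ψ₁ z ≠ 0 := fun z hz => hV₃ z hz.2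
  have hdivc : ∀ {k : ℝ × ℝ → ℝ}, ContinuousOn k V₁ → ContinuousOn (fun z => k z / s z) V₁ :=
    fun hk => hk.div (hss.mono hsV).continuousOn hne
  refine ⟨V₁ ∩ V₂ ∩ V₃, (hV₁o.inter hV₂o).inter hV₃o, ⟨⟨hzV₁, hzV₂⟩, hzV₃⟩,
    (hsub.trans hsV).trans hVsU, φ, ψ, ⟨hφs.mono hsub, hψs.mono hsub,
      hinj.mono fun z hz => hz.1.2, fun z hz => ?_⟩, fun I y hy => ?_⟩
  · rw [(hφ.hasFDerivAt z (hsub hz)).partialX_eq, (hφ.hasFDerivAt z (hsub hz)).partialY_eq,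
      (hψ.hasFDerivAt z (hsub hz)).partialX_eq, (hψ.hasFDerivAt z (hsub hz)).partialY_eq]
    exact hJ z hz
  · have hV₁U : V₁ ⊆ U := hsV.trans hVsU
    refine solvesSecondOrder_iff_image_in_line (hφ.mono hsub) (hψ.mono hsub) hJ
      (((h.smooth_a.continuousOn.mono hV₁U).add
        (continuousOn_const.mul (hdivc hs₁c))).mono hsub)
      (((h.smooth_b.continuousOn.mono hV₁U).add (hdivc hs₂c)).mono hsub)
      (h.smooth_c.continuousOn.mono (hsub.trans hV₁U)) (fun x y p hxy => ?_) hy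
    rw [hG x y p (hV₁U (hsub hxy))]
    ring

end PointTransformation

/-! ### The Lie criteria as integrability conditions; the cubic and its total derivative -/

section LieCriteria

open Filter Topology

theorem ContDiffOn.hasFDerivAt_planeForm {U : Set (ℝ × ℝ)} (hU : IsOpen U) {k : ℝ × ℝ → ℝ}
    (hk : ContDiffOn ℝ ∞ k U) {z : ℝ × ℝ} (hz : z ∈ U) :
    HasFDerivAt k (planeForm (partialX k z) (partialY k z)) z := by
  refine ((hk.contDiffAt (hU.mem_nhds hz)).differentiableAt
    (by simp)).hasFDerivAt.congr_fderiv ?_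
  ext <;> simp [fderiv_apply_eq_partials]

theorem ContDiffOn.partialX {U : Set (ℝ × ℝ)} (hU : IsOpen U) {k : ℝ × ℝ → ℝ}
    (hk : ContDiffOn ℝ ∞ k U) : ContDiffOn ℝ ∞ (partialX k) U :=
  (hk.fderiv_of_isOpen hU (by simp)).clm_apply contDiffOn_const

theorem ContDiffOn.partialY {U : Set (ℝ × ℝ)} (hU : IsOpen U) {k : ℝ × ℝ → ℝ}
    (hk : ContDiffOn ℝ ∞ k U) : ContDiffOn ℝ ∞ (partialY k) U :=
  (hk.fderiv_of_isOpen hU (by simp)).clm_apply contDiffOn_const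

theorem partialX_partialY_comm {U : Set (ℝ × ℝ)} (hU : IsOpen U) {k : ℝ × ℝ → ℝ}
    (hk : ContDiffOn ℝ ∞ k U) {z : ℝ × ℝ} (hz : z ∈ U) :
    partialX (partialY k) z = partialY (partialX k) z := by
  have hd : DifferentiableAt ℝ (fderiv ℝ k) z :=
    ((hk.fderiv_of_isOpen (m := ∞) hU (by simp)).contDiffAt
      (hU.mem_nhds hz)).differentiableAt (by simp)
  have hsymm := (hk.contDiffAt (hU.mem_nhds hz)).isSymmSndFDerivAt
    (by simpa using WithTop.coe_le_coe.2 (le_top : (2 : ℕ∞) ≤ ⊤))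
  have happ : ∀ v w : ℝ × ℝ, fderiv ℝ (fun x => fderiv ℝ k x v) z w
      = fderiv ℝ (fderiv ℝ k) z w v := fun v w => by
    rw [fderiv_clm_apply hd (differentiableAt_const v)]
    simp
  change fderiv ℝ (fun x => fderiv ℝ k x (0, 1)) z (1, 0)
    = fderiv ℝ (fun x => fderiv ℝ k x (1, 0)) z (0, 1)
  rw [happ, happ]
  exact hsymm.eq _ _

theorem HasFDerivAt.planeForm_add {k l : ℝ × ℝ → ℝ} {p q p' q' : ℝ} {z : ℝ × ℝ}
    (hk : HasFDerivAt k (planeForm p q) z) (hl : HasFDerivAt l (planeForm p' q') z) :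
    HasFDerivAt (fun w => k w + l w) (planeForm (p + p') (q + q')) z := by
  refine (hk.add hl).congr_fderiv ?_
  ext <;> simp

theorem HasFDerivAt.planeForm_const_mul {k : ℝ × ℝ → ℝ} {p q : ℝ} {z : ℝ × ℝ}
    (hk : HasFDerivAt k (planeForm p q) z) (r : ℝ) :
    HasFDerivAt (fun w => r * k w) (planeForm (r * p) (r * q)) z := by
  refine (hk.const_mul r).congr_fderiv ?_
  ext <;> simp

/-- The Lie criteria are the integrability conditions of the linear system attached to the
trace-free connection of the projective structure. -/
theorem LieCriteria.isFlatHessianSystem {U : Set (ℝ × ℝ)} (hU : IsOpen U)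
    {c d g h : ℝ × ℝ → ℝ} (hc : ContDiffOn ℝ ∞ c U) (hd : ContDiffOn ℝ ∞ d U)
    (hg : ContDiffOn ℝ ∞ g U) (hh : ContDiffOn ℝ ∞ h U) (hL : LieCriteria U c d g h) :
    IsFlatHessianSystem U (fun z => 1 / 3 * h z) (fun z => -1 / 3 * g z) c d
      (fun z => -1 / 3 * h z) (fun z => 1 / 3 * g z)
      (fun z => 2 / 3 * (d z * g z) - 2 / 9 * (h z * h z) - partialY d z - 1 / 3 * partialX h z)
      (fun z => 1 / 3 * partialY h z + 1 / 3 * partialX g z + 1 / 9 * (h z * g z) - d z * c z)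
      (fun z => 2 / 3 * (c z * h z) - 2 / 9 * (g z * g z) - partialX c z
        - 1 / 3 * partialY g z) := by
  have hdy := hd.partialY hU
  have hhx := hh.partialX hU
  have hhy := hh.partialY hU
  have hgx := hg.partialX hU
  have hgy := hg.partialY hU
  have hcx := hc.partialX hU
  have D : ∀ {k : ℝ × ℝ → ℝ}, ContDiffOn ℝ ∞ k U → ∀ {z}, z ∈ U →
      HasFDerivAt k (planeForm (partialX k z) (partialY k z)) z :=
    fun hk _ hz => hk.hasFDerivAt_planeForm hU hz
  have DP := fun z (hz : z ∈ U) => (((((D hd hz).planeForm_mul (D hg hz)).planeForm_const_mul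
    (2 / 3)).planeForm_sub (((D hh hz).planeForm_mul (D hh hz)).planeForm_const_mul
    (2 / 9))).planeForm_sub (D hdy hz)).planeForm_sub ((D hhx hz).planeForm_const_mul (1 / 3))
  have DQ := fun z (hz : z ∈ U) => ((((D hhy hz).planeForm_const_mul (1 / 3)).planeForm_add
    ((D hgx hz).planeForm_const_mul (1 / 3))).planeForm_add
    (((D hh hz).planeForm_mul (D hg hz)).planeForm_const_mul (1 / 9))).planeForm_sub
    ((D hd hz).planeForm_mul (D hc hz))
  have DR := fun z (hz : z ∈ U) => (((((D hc hz).planeForm_mul (D hh hz)).planeForm_const_mul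
    (2 / 3)).planeForm_sub (((D hg hz).planeForm_mul (D hg hz)).planeForm_const_mul
    (2 / 9))).planeForm_sub (D hcx hz)).planeForm_sub ((D hgy hz).planeForm_const_mul (1 / 3))
  have Dh := fun (r : ℝ) z (hz : z ∈ U) => (D hh hz).planeForm_const_mul r
  have Dg := fun (r : ℝ) z (hz : z ∈ U) => (D hg hz).planeForm_const_mul r
  refine ⟨by fun_prop, by fun_prop, hc, hd, by fun_prop, by fun_prop, by fun_prop, by fun_prop,
    by fun_prop, fun z hz => ?_, fun z hz => ?_, fun z hz => ?_, fun z hz => ?_, fun z hz => ?_,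
    fun z hz => ?_⟩
  -- The conditions on the coefficients of s_x and s_y hold identically: they are what determines P,
  -- Q, R, and the two that involve Q agree because a + e = b + f = 0. Only the two conditions on
  -- the coefficient of s use the Lie criteria.
  · rw [(Dh _ z hz).partialY_eq, (Dg _ z hz).partialX_eq]
    ring
  · rw [(Dh _ z hz).partialX_eq]
    ring
  · rw [(DQ z hz).partialX_eq, (DP z hz).partialY_eq]
    have e := hL.second z hz
    rw [((D hd hz).planeForm_mul (D hg hz)).partialY_eq] at e
    have e' := partialX_partialY_comm hU hh hz
    linear_combination -1 / 3 * e + 1 / 3 * e'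
  · rw [(Dg _ z hz).partialY_eq]
    ring
  · rw [(Dg _ z hz).partialX_eq, (Dh _ z hz).partialY_eq]
    ring
  · rw [(DR z hz).partialX_eq, (DQ z hz).partialY_eq]
    have e := hL.first z hz
    rw [((D hc hz).planeForm_mul (D hh hz)).partialX_eq] at e
    have e' := partialX_partialY_comm hU hg hz
    linear_combination 1 / 3 * e - 1 / 3 * e'

/-- The Lie criteria with auxiliary functions say that the connection is flat. -/
theorem LieCriteriaAux.isFlatHessianSystem {U : Set (ℝ × ℝ)} (hU : IsOpen U)
    {c d g h a b e f : ℝ × ℝ → ℝ} (hc : ContDiffOn ℝ ∞ c U) (hd : ContDiffOn ℝ ∞ d U)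
    (hg : ContDiffOn ℝ ∞ g U) (hh : ContDiffOn ℝ ∞ h U)
    (hL : LieCriteriaAux U c d g h a b e f) :
    IsFlatHessianSystem U a b c d e f 0 0 0 := by
  have D : ∀ {k : ℝ × ℝ → ℝ}, ContDiffOn ℝ ∞ k U → ∀ {z}, z ∈ U →
      HasFDerivAt k (planeForm (partialX k z) (partialY k z)) z :=
    fun hk _ hz => hk.hasFDerivAt_planeForm hU hz
  -- The criteria contain no derivatives of `a` and `f`, so these are rewritten through a = h + 2e
  -- and f = g + 2b.
  have Da : ∀ z ∈ U, HasFDerivAt a (planeForm (partialX h z + 2 * partialX e z)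
      (partialY h z + 2 * partialY e z)) z := fun z hz =>
    ((D hh hz).planeForm_add ((D hL.smooth_e hz).planeForm_const_mul 2)).congr_of_eventuallyEq
      ((hU.eventually_mem hz).mono fun w hw => by linear_combination -hL.h_eq w hw)
  have Df : ∀ z ∈ U, HasFDerivAt f (planeForm (partialX g z + 2 * partialX b z)
      (partialY g z + 2 * partialY b z)) z := fun z hz =>
    ((D hg hz).planeForm_add ((D hL.smooth_b hz).planeForm_const_mul 2)).congr_of_eventuallyEq
      ((hU.eventually_mem hz).mono fun w hw => by linear_combination -hL.g_eq w hw)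
  have D0 : ∀ z : ℝ × ℝ, HasFDerivAt (0 : ℝ × ℝ → ℝ) (planeForm 0 0) z := fun z => by
    exact (hasFDerivAt_const (0 : ℝ) z).congr_fderiv (by simp [planeForm])
  have h0 : ContDiffOn ℝ ∞ (0 : ℝ × ℝ → ℝ) U := contDiffOn_const
  refine ⟨hL.smooth_a, hL.smooth_b, hc, hd, hL.smooth_e, hL.smooth_f, h0, h0, h0,
    fun z hz => ?_, fun z hz => ?_, fun z hz => ?_, fun z hz => ?_, fun z hz => ?_,
    fun z hz => ?_⟩
  · rw [(Da z hz).partialY_eq]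
    simp only [Pi.zero_apply]
    linear_combination -1 / 3 * hL.first z hz + 2 / 3 * hL.fourth z hz
  · simp only [Pi.zero_apply]
    linear_combination hL.third z hz + e z * hL.h_eq z hz + d z * hL.g_eq z hz
  · simp [(D0 z).partialX_eq, (D0 z).partialY_eq]
  · simp only [Pi.zero_apply]
    linear_combination hL.second z hz - c z * hL.h_eq z hz - b z * hL.g_eq z hz
  · rw [(Df z hz).partialX_eq]
    simp only [Pi.zero_apply]
    linear_combination 2 / 3 * hL.first z hz - 1 / 3 * hL.fourth z hz
  · simp [(D0 z).partialX_eq, (D0 z).partialY_eq]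

/-- The cubic `c p³ - g p² + h p - d` in `p` with coefficients depending on `(x, y)`. -/
def cubicTerms (c d g h : ℝ × ℝ → ℝ) (w : ℝ × ℝ × ℝ) : ℝ :=
  c (w.1, w.2.1) * w.2.2 ^ 3 - g (w.1, w.2.1) * w.2.2 ^ 2 + h (w.1, w.2.1) * w.2.2
    - d (w.1, w.2.1)

theorem contDiffOn_cubicTerms {U : Set (ℝ × ℝ)} {c d g h : ℝ × ℝ → ℝ}
    (hc : ContDiffOn ℝ ∞ c U) (hd : ContDiffOn ℝ ∞ d U)
    (hg : ContDiffOn ℝ ∞ g U) (hh : ContDiffOn ℝ ∞ h U) :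
    ContDiffOn ℝ ∞ (cubicTerms c d g h) {w | (w.1, w.2.1) ∈ U} := by
  have hπ : ContDiff ℝ ∞ fun w : ℝ × ℝ × ℝ => (w.1, w.2.1) := by fun_prop
  have hp : ContDiff ℝ ∞ fun w : ℝ × ℝ × ℝ => w.2.2 := by fun_prop
  have C : ∀ {k : ℝ × ℝ → ℝ}, ContDiffOn ℝ ∞ k U →
      ContDiffOn ℝ ∞ (fun w : ℝ × ℝ × ℝ => k (w.1, w.2.1)) {w | (w.1, w.2.1) ∈ U} :=
    fun hk => hk.comp hπ.contDiffOn fun _ hw => hw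
  exact ((((C hc).mul (hp.pow 3).contDiffOn).sub ((C hg).mul (hp.pow 2).contDiffOn)).add
    ((C hh).mul hp.contDiffOn)).sub (C hd)

theorem fderiv_cubicTerms {c d g h : ℝ × ℝ → ℝ} {x y : ℝ} {cx cy dx dy gx gy hx hy : ℝ}
    (hc : HasFDerivAt c (planeForm cx cy) (x, y)) (hd : HasFDerivAt d (planeForm dx dy) (x, y))
    (hg : HasFDerivAt g (planeForm gx gy) (x, y)) (hh : HasFDerivAt h (planeForm hx hy) (x, y))
    (p q : ℝ) :
    fderiv ℝ (cubicTerms c d g h) (x, y, p) (1, p, q) =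
      (cx + p * cy) * p ^ 3 - (gx + p * gy) * p ^ 2 + (hx + p * hy) * p - (dx + p * dy)
        + (3 * c (x, y) * p ^ 2 - 2 * g (x, y) * p + h (x, y)) * q := by
  let π : ℝ × ℝ × ℝ →L[ℝ] ℝ × ℝ := (ContinuousLinearMap.fst ℝ ℝ (ℝ × ℝ)).prod
    ((ContinuousLinearMap.fst ℝ ℝ ℝ).comp (ContinuousLinearMap.snd ℝ ℝ (ℝ × ℝ)))
  let π' : ℝ × ℝ × ℝ →L[ℝ] ℝ :=
    (ContinuousLinearMap.snd ℝ ℝ ℝ).comp (ContinuousLinearMap.snd ℝ ℝ (ℝ × ℝ))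
  have hπ : HasFDerivAt π π (x, y, p) := π.hasFDerivAt
  have hπ' : HasFDerivAt π' π' (x, y, p) := π'.hasFDerivAt
  have C : ∀ {k : ℝ × ℝ → ℝ} {kx ky : ℝ}, HasFDerivAt k (planeForm kx ky) (x, y) →
      HasFDerivAt (fun w : ℝ × ℝ × ℝ => k (w.1, w.2.1)) ((planeForm kx ky).comp π) (x, y, p) :=
    fun hk => HasFDerivAt.comp (x, y, p) (f := π) hk hπ
  have H : HasFDerivAt (cubicTerms c d g h) _ (x, y, p) :=
    ((((C hc).mul (hπ'.pow 3)).sub ((C hg).mul (hπ'.pow 2))).add ((C hh).mul hπ')).sub (C hd)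
  rw [H.fderiv]
  simp [π, π']
  ring

end LieCriteria

/-! ### The main theorem -/

theorem theorem2 (U : Set (ℝ × ℝ)) (hU : IsOpen U)
    (A₀ A₁ A₂ B₀ B₁ B₂ B₃ B₄ : ℝ × ℝ → ℝ)
    (hA₀ : ContDiffOn ℝ ∞ A₀ U) (hA₁ : ContDiffOn ℝ ∞ A₁ U) (hA₂ : ContDiffOn ℝ ∞ A₂ U)
    (c d g h : ℝ × ℝ → ℝ) (hd : ContDiffOn ℝ ∞ d U)
    -- the coefficients `c`, `g`, `h`
    (hc : ∀ z ∈ U, c z = A₂ z / 3)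
    (hg : ∀ z ∈ U, g z = A₁ z / 2)
    (hh : ∀ z ∈ U, h z = A₀ z)
    -- the constraints on `B₄`, `B₃`, `B₂`
    (hB₄ : ∀ z ∈ U, B₄ z = partialY A₂ z / 3)
    (hB₃ : ∀ z ∈ U, B₃ z = partialY A₁ z / 2 - partialX A₂ z / 3)
    (hB₂ : ∀ z ∈ U, B₂ z = partialY A₀ z - partialX A₁ z / 2)
    -- the two differential equations that determine `d` up to a constant
    (hd_x : ∀ z ∈ U, partialX d z = -B₀ z)
    (hd_y : ∀ z ∈ U, partialY d z = B₁ z + partialX A₀ z)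
    -- the Lie criteria, in either of their two forms
    (hLie : LieCriteria U c d g h ∨
      ∃ a b e f p q r : ℝ × ℝ → ℝ,
        LieCriteriaAux U c d g h a b e f ∧ MetricConsistent U a b c d e f p q r) :
    LinearizableThirdOrder U (thirdOrderTerms A₀ A₁ A₂ B₀ B₁ B₂ B₃ B₄) := by
  have hcs : ContDiffOn ℝ ∞ c U := (hA₂.div_const 3).congr hc
  have hgs : ContDiffOn ℝ ∞ g U := (hA₁.div_const 2).congr hg
  have hhs : ContDiffOn ℝ ∞ h U := hA₀.congr hh
  refine ⟨cubicTerms c d g h, contDiffOn_cubicTerms hcs hd hgs hhs, fun x y p q hz => ?_, ?_⟩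
  · have hev := hU.eventually_mem hz
    have Dc := ((hA₂.hasFDerivAt_planeForm hU hz).planeForm_const_mul (1 / 3)).congr_of_eventuallyEq
      (hev.mono fun w hw => (hc w hw).trans (by ring))
    have Dg := ((hA₁.hasFDerivAt_planeForm hU hz).planeForm_const_mul (1 / 2)).congr_of_eventuallyEq
      (hev.mono fun w hw => (hg w hw).trans (by ring))
    have Dh := (hA₀.hasFDerivAt_planeForm hU hz).congr_of_eventuallyEq (hev.mono hh)
    -- The terms in y'' give 3c, 2g, h = A₂, A₁, A₀; the powers of y' give c_y = B₄, g_y - c_x = B₃,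
    -- h_y - g_x = B₂, d_y - h_x = B₁ and -d_x = B₀.
    rw [fderiv_cubicTerms Dc (hd.hasFDerivAt_planeForm hU hz) Dg Dh]
    simp only [thirdOrderTerms]
    rw [hc _ hz, hg _ hz, hh _ hz, hB₄ _ hz, hB₃ _ hz, hB₂ _ hz, hd_x _ hz, hd_y _ hz]
    ring
  · rcases hLie with hL | ⟨a, b, e, f, -, -, -, hL, -⟩
    · refine (hL.isFlatHessianSystem hU hcs hd hgs hhs).pointLinearizable hU fun x y p _ => ?_
      simp only [cubicTerms]
      ring
    · refine (hL.isFlatHessianSystem hU hcs hd hgs hhs).pointLinearizable hU fun x y p hz => ?_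
      simp only [cubicTerms, hL.h_eq _ hz, hL.g_eq _ hz]
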